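/- Let $B_2:\mathbb R\to\mathbb R$ be the hat function $B_2(x)=1+x$ for $x\in[-1,0]$, $B_2(x)=1-x$ for $x\in[0,1]$ and $B_2(x)=0$ otherwise, and let $a=1$, $b=\frac25$. On $L^2(\mathbb R)$ (complex-valued functions) let $(T_pg)(x)=g(x-p)$ and $(E_qg)(x)=e^{2\pi i q x}g(x)$. For a frame $\{f_i\}_{i\in I}$ of a Hilbert space $H$ with frame operator $Sf=\sum_{i}\langle f,f_i\rangle f_i$, a family $\{\omega_j\}_{j\in I}$ is called an R-dual of type II of $\{f_i\}_{i\in I}$ if there are orthonormal bases $\{e_i\}_{i\in I}$, $\{h_i\}_{i\in I}$ of $H$ such that $\omega_j=\sum_{i\in I}\langle f_i,S^{-1/2}e_j\rangle S^{1/2}h_i$ for all $j\in I$. Then: 1. $\{E_{mb}T_{na}B_2\}_{m,n\in\mathbb Z}$ is a frame for $L^2(\mathbb R)$, and $\{\omega_{m,n}\}_{m,n\in\mathbb Z}$ with $\omega_{m,n}=\frac1{\sqrt{ab}}E_{m/a}T_{n/b}B_2$ is a Riesz sequence in $L^2(\mathbb R)$. 2. If $S$ denotes the frame operator of $\{E_{mb}T_{na}B_2\}_{m,n\in\mathbb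 Z}$, then $\|S^{-1/2}\omega_{0,1}\|^2=1+\frac{\pi}{4}-\ln 2\neq 1$. 3. $\{\omega_{m,n}\}_{m,n\in\mathbb Z}$ is not an R-dual of type II of $\{E_{mb}T_{na}B_2\}_{m,n\in\mathbb Z}$. 4. Consequently R-duals of type II do not generalize the duality principle: it is not true that for all $a,b>0$ and $g\in L^2(\mathbb R)$ for which $\{E_{mb}T_{na}g\}_{m,n\in\mathbb Z}$ is a frame for $L^2(\mathbb R)$, the family $\{\frac1{\sqrt{ab}}E_{m/a}T_{n/b}g\}_{m,n\in\mathbb Z}$ is an R-dual of type II of $\{E_{mb}T_{na}g\}_{m,n\in\mathbb Z}$. -/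

import Mathlib

open MeasureTheory
open scoped ENNReal

noncomputable section

namespace RDual

section Abstract

variable {I H : Type*} [NormedAddCommGroup H] [InnerProductSpace ℂ H]

/-- `A`, `B` are frame bounds of the family `f`: they are strictly positive and
`A ‖x‖² ≤ ∑ᵢ |⟨x, fᵢ⟩|² ≤ B ‖x‖²` for all `x` (the series being convergent). -/
def HasFrameBounds (f : I → H) (A B : ℝ) : Prop :=
  0 < A ∧ 0 < B ∧ ∀ x : H,
    Summable (fun i => ‖inner ℂ (f i) x‖ ^ 2) ∧
      A * ‖x‖ ^ 2 ≤ ∑' i, ‖inner ℂ (f i) x‖ ^ 2 ∧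
      ∑' i, ‖inner ℂ (f i) x‖ ^ 2 ≤ B * ‖x‖ ^ 2

/-- The family `f` is a frame for `H`. -/
def IsFrame (f : I → H) : Prop := ∃ A B : ℝ, HasFrameBounds f A B

/-- The family `f` satisfies the upper frame condition. -/
def IsBessel (f : I → H) : Prop :=
  ∃ B : ℝ, 0 < B ∧ ∀ x : H,
    Summable (fun i => ‖inner ℂ (f i) x‖ ^ 2) ∧
      ∑' i, ‖inner ℂ (f i) x‖ ^ 2 ≤ B * ‖x‖ ^ 2

theorem IsFrame.isBessel {f : I → H} (hf : IsFrame f) : IsBessel f := by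
  obtain ⟨A, B, _, hB, h⟩ := hf
  exact ⟨B, hB, fun x => ⟨(h x).1, (h x).2.2⟩⟩

/-- `A`, `B` are Riesz bounds of the family `f`: `0 < A ≤ B` and
`A ∑ |cᵢ|² ≤ ‖∑ cᵢ fᵢ‖² ≤ B ∑ |cᵢ|²` for all finite scalar families `c`. -/
def HasRieszBounds (f : I → H) (A B : ℝ) : Prop :=
  0 < A ∧ A ≤ B ∧ ∀ (s : Finset I) (c : I → ℂ),
    A * ∑ i ∈ s, ‖c i‖ ^ 2 ≤ ‖∑ i ∈ s, c i • f i‖ ^ 2 ∧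
      ‖∑ i ∈ s, c i • f i‖ ^ 2 ≤ B * ∑ i ∈ s, ‖c i‖ ^ 2

/-- The family `f` is a Riesz sequence in `H`. -/
def IsRieszSequence (f : I → H) : Prop := ∃ A B : ℝ, HasRieszBounds f A B

theorem IsBessel.memℓp {f : I → H} (hf : IsBessel f) (x : H) :
    Memℓp (fun i => inner ℂ (f i) x) 2 := by
  obtain ⟨B, _, h⟩ := hf
  apply memℓp_gen
  simpa using (h x).1

/-- The analysis operator `U : H → ℓ²(I)`, `U x = (⟨x, fᵢ⟩)ᵢ`. -/
def analysisOperator (f : I → H) (hf : IsBessel f) : H →L[ℂ] lp (fun _ : I => ℂ) 2 :=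
  LinearMap.mkContinuousOfExistsBound
    { toFun := fun x => ⟨fun i => inner ℂ (f i) x, hf.memℓp x⟩
      map_add' := fun x y => by
        ext i
        exact inner_add_right _ _ _
      map_smul' := fun c x => by
        ext i
        exact inner_smul_right _ _ _ }
    (by
      obtain ⟨B, hB, h⟩ := hf
      refine ⟨Real.sqrt B, fun x => ?_⟩
      refine le_of_sq_le_sq ?_ (by positivity)
      have := lp.norm_rpow_eq_tsum (p := 2) (by norm_num)
        (⟨fun i => inner ℂ (f i) x, IsBessel.memℓp ⟨B, hB, h⟩ x⟩ : lp (fun _ : I => ℂ) 2)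
      simp only [ENNReal.toReal_ofNat, Real.rpow_ofNat] at this
      rw [mul_pow, Real.sq_sqrt hB.le]
      exact this.trans_le (h x).2)

variable [CompleteSpace H]

open Classical in
/-- The frame operator `S = U* U`, that is, `S x = ∑ᵢ ⟨x, fᵢ⟩ fᵢ` (see `hasSum_frameOperator`).
It has the value `0` if `f` does not satisfy the upper frame condition. -/
def frameOperator (f : I → H) : H →L[ℂ] H :=
  if hf : IsBessel f then
    (ContinuousLinearMap.adjoint (analysisOperator f hf)).comp (analysisOperator f hf)
  else 0

theorem hasSum_frameOperator {f : I → H} (hf : IsBessel f) (x : H) :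
    HasSum (fun i => inner ℂ (f i) x • f i) (frameOperator f x) := by
  classical
  have hU : ∀ i, ContinuousLinearMap.adjoint (analysisOperator f hf)
      (lp.single 2 i (inner ℂ (f i) x)) = inner ℂ (f i) x • f i := by
    intro i
    refine ext_inner_right ℂ fun y => ?_
    rw [ContinuousLinearMap.adjoint_inner_left, lp.inner_single_left, inner_smul_left]
    simp [analysisOperator, mul_comm]
  have h := (lp.hasSum_single (p := 2) (by norm_num) (analysisOperator f hf x)).mapL
    (ContinuousLinearMap.adjoint (analysisOperator f hf))
  rw [frameOperator, dif_pos hf]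
  exact h.congr_fun fun i => (hU i).symm

/-- The positive square root `S^{1/2}` of the frame operator `S` of `f`
(a real power in the continuous functional calculus of bounded operators). -/
def frameOperatorSqrt (f : I → H) : H →L[ℂ] H := frameOperator f ^ (1 / 2 : ℝ)

/-- The inverse square root `S^{-1/2}` of the frame operator `S` of `f`. -/
def frameOperatorInvSqrt (f : I → H) : H →L[ℂ] H := frameOperator f ^ (-(1 / 2) : ℝ)

/-- `ω` is an R-dual of type II of the frame `f`: for some orthonormal bases `e`, `h` of `H`,
`ωⱼ = ∑ᵢ ⟨fᵢ, S^{-1/2} eⱼ⟩ S^{1/2} hᵢ` for all `j`, where `S` is the frame operator of `f`.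
(Mathlib's `inner ℂ u v` is linear in `v`.) -/
def IsRDualTypeII (f ω : I → H) : Prop :=
  IsFrame f ∧ ∃ e h : HilbertBasis I ℂ H, ∀ j : I,
    HasSum
      (fun i => inner ℂ (frameOperatorInvSqrt f (e j)) (f i) • frameOperatorSqrt f (h i))
      (ω j)

end Abstract

section Gabor

/-- The Hilbert space `L²(ℝ)` of complex-valued functions. -/
abbrev L2R : Type := Lp ℂ 2 (volume : Measure ℝ)

/-- Translation on `L²(ℝ)`: `(T_p g)(x) = g(x - p)`. -/
def translation (p : ℝ) (g : L2R) : L2R :=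
  Lp.compMeasurePreserving (fun x : ℝ => x - p) (measurePreserving_sub_right volume p) g

theorem memLp_modulation (q : ℝ) (g : L2R) :
    MemLp (fun x : ℝ => Complex.exp (2 * Real.pi * Complex.I * q * x) * g x) 2 volume := by
  refine (Lp.memLp g).of_le_mul (c := 1) ?_ ?_
  · exact (by fun_prop : Continuous fun x : ℝ =>
      Complex.exp (2 * Real.pi * Complex.I * q * x)).aestronglyMeasurable.mul
        (Lp.aestronglyMeasurable g)
  · refine Filter.Eventually.of_forall fun x => ?_
    have : (2 * Real.pi * Complex.I * q * x : ℂ) = ((2 * Real.pi * q * x : ℝ) : ℂ) * Complex.I := by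
      push_cast
      ring
    rw [norm_mul, this, Complex.norm_exp_ofReal_mul_I]

/-- Modulation on `L²(ℝ)`: `(E_q g)(x) = e^{2πiqx} g(x)`. -/
def modulation (q : ℝ) (g : L2R) : L2R := (memLp_modulation q g).toLp _

/-- The Gabor system `(E_{mb} T_{na} g)`, indexed by `(m, n) ∈ ℤ × ℤ`. -/
def gaborSystem (a b : ℝ) (g : L2R) (k : ℤ × ℤ) : L2R :=
  modulation (k.1 * b) (translation (k.2 * a) g)

/-- The normalized adjoint Gabor system `((ab)^{-1/2} E_{m/a} T_{n/b} g)`, indexed by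
`(m, n) ∈ ℤ × ℤ`. -/
def adjointGaborSystem (a b : ℝ) (g : L2R) (k : ℤ × ℤ) : L2R :=
  ((1 / Real.sqrt (a * b) : ℝ) : ℂ) • modulation (k.1 / a) (translation (k.2 / b) g)

open Classical in
/-- The hat function (B-spline of order two). -/
def hat (x : ℝ) : ℝ :=
  if x ∈ Set.Icc (-1) 0 then 1 + x else if x ∈ Set.Icc 0 1 then 1 - x else 0

theorem hat_eq (x : ℝ) : hat x = max 0 (1 - |x|) := by
  unfold hat
  simp only [Set.mem_Icc]
  split_ifs with h1 h2
  · rw [abs_of_nonpos h1.2, max_eq_right] <;> linarith [h1.1]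
  · rw [abs_of_nonneg h2.1, max_eq_right]; linarith [h2.2]
  · rw [max_eq_left]
    by_contra! h
    have := abs_lt.1 (show |x| < 1 by linarith)
    rcases le_total x 0 with h0 | h0
    · exact h1 ⟨this.1.le, h0⟩
    · exact h2 ⟨h0, this.2.le⟩

theorem memLp_hat : MemLp (fun x : ℝ => (hat x : ℂ)) 2 volume := by
  have hc : Continuous (fun x : ℝ => (hat x : ℂ)) := by
    simp only [hat_eq]
    fun_prop
  refine hc.memLp_of_hasCompactSupport ?_
  refine HasCompactSupport.intro (K := Set.Icc (-1) 1) isCompact_Icc fun x hx => ?_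
  have : hat x = 0 := by
    rw [hat_eq, max_eq_left]
    by_contra! h
    have := abs_lt.1 (show |x| < 1 by linarith)
    exact hx ⟨this.1.le, this.2.le⟩
  simp [this]

/-- The hat function as an element of `L²(ℝ)`. -/
def hatL2 : L2R := memLp_hat.toLp _

end Gabor

end RDual

end

open RDual

/-!
An R-dual of type II has a rigid consequence: `S^{-1/2} ωⱼ = ∑ᵢ ⟨fᵢ, S^{-1/2} eⱼ⟩ hᵢ` has squared
norm `∑ᵢ |⟨fᵢ, S^{-1/2} eⱼ⟩|² = ⟨S S^{-1/2} eⱼ, S^{-1/2} eⱼ⟩ = 1`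
(`IsRDualTypeII.norm_frameOperatorInvSqrt_eq_one`). So it is enough to exhibit one element of the
adjoint Gabor system for which `‖S^{-1/2} ω‖ ≠ 1`.

For the hat function with `a = 1`, `b = 2/5` everything is explicit. The support of the window has
length `2 ≤ 1/b`, so by Parseval's identity on intervals of length `1/b`
(`hasSum_norm_sq_integral_exp`) the quadratic form of `S` is `(5/2) ∫ G |f|²`, where
`G(x) = ∑ₙ hat(x - n)²` is 1-periodic with values in `[1/2, 1]`. This gives the frame property
(`hasFrameBounds_gaborSystem`), and by polarization `S` is multiplication by `(5/2) G`
(`frameOperator_gaborSystem`). Hence `‖S^{-1/2} ω_{0,1}‖² = ⟨ω_{0,1}, S⁻¹ ω_{0,1}⟩ =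
∫ hat(x - 5/2)² / G(x) dx`, an elementary integral (`integral_hat_sq_div_hatSum`).

The Riesz property of the adjoint system is proved directly: translates by distinct multiples of
`5/2` have disjoint supports and are orthogonal, and for a single translate the integral of
`|∑ₘ cₘ e^{2πimx}|² hat(x - t)²` folds onto one period, with a weight between `1/2` and `1`
(`integral_norm_sq_trigSum_mul_hat_bounds`).
-/

namespace RDual

/-! ### The frame operator and R-duals of type II -/

section FrameOperator

variable {I H : Type*} [NormedAddCommGroup H] [InnerProductSpace ℂ H] [CompleteSpace H]

theorem frameOperator_nonneg (f : I → H) : 0 ≤ frameOperator f := by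
  classical
  unfold frameOperator
  split_ifs with hf
  · rw [ContinuousLinearMap.nonneg_iff_isPositive]
    exact ContinuousLinearMap.isPositive_adjoint_comp_self _
  · exact le_rfl

theorem inner_frameOperator_self {f : I → H} (hf : IsBessel f) (x : H) :
    inner ℂ (frameOperator f x) x = ((∑' i, ‖inner ℂ (f i) x‖ ^ 2 : ℝ) : ℂ) := by
  have h1 := (hasSum_frameOperator hf x).mapL (innerSL ℂ x)
  obtain ⟨B, _, h⟩ := hf
  have h2 := Complex.hasSum_ofReal.2 (h x).1.hasSum
  have h3 : inner ℂ x (frameOperator f x) = ((∑' i, ‖inner ℂ (f i) x‖ ^ 2 : ℝ) : ℂ) := by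
    refine h1.unique (h2.congr_fun fun i => ?_)
    rw [innerSL_apply_apply, inner_smul_right, ← inner_conj_symm x (f i), Complex.mul_conj,
      Complex.normSq_eq_norm_sq]
  rw [← inner_conj_symm, h3, Complex.conj_ofReal]

/-- By polarization, the frame operator is the only operator whose quadratic form is
`x ↦ ∑ᵢ |⟨x, fᵢ⟩|²`. -/
theorem frameOperator_eq_of_inner_self {f : I → H} (hf : IsBessel f) (M : H →ₗ[ℂ] H)
    (hM : ∀ x, inner ℂ (M x) x = ((∑' i, ‖inner ℂ (f i) x‖ ^ 2 : ℝ) : ℂ)) (x : H) :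
    frameOperator f x = M x := by
  have h : (frameOperator f : H →ₗ[ℂ] H) - M = 0 := by
    rw [← inner_map_self_eq_zero]
    intro y
    rw [LinearMap.sub_apply, inner_sub_left, hM]
    exact sub_eq_zero.2 (inner_frameOperator_self hf y)
  exact sub_eq_zero.1 (LinearMap.congr_fun h x)

theorem IsFrame.isStrictlyPositive_frameOperator {f : I → H} (hf : IsFrame f) :
    IsStrictlyPositive (frameOperator f) := by
  have hB := hf.isBessel
  obtain ⟨A, B, hA, _, h⟩ := hf
  refine IsUnit.isStrictlyPositive ?_ (frameOperator_nonneg f)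
  refine ContinuousLinearMap.isUnit_of_forall_le_norm_inner_map _ (c := ⟨A, hA.le⟩) hA fun x => ?_
  rw [inner_frameOperator_self hB, Complex.norm_real]
  exact (mul_comm _ _).trans_le ((h x).2.1.trans (le_abs_self _))

theorem frameOperatorInvSqrt_comp_frameOperatorSqrt {f : I → H} (hf : IsFrame f) (x : H) :
    frameOperatorInvSqrt f (frameOperatorSqrt f x) = x :=
  congrArg (fun T : H →L[ℂ] H => T x)
    (CFC.rpow_neg_mul_rpow (1 / 2 : ℝ) hf.isStrictlyPositive_frameOperator)

theorem inner_frameOperatorInvSqrt_left (f : I → H) (x y : H) :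
    inner ℂ (frameOperatorInvSqrt f x) y = inner ℂ x (frameOperatorInvSqrt f y) :=
  ((ContinuousLinearMap.nonneg_iff_isPositive _).1
    (CFC.rpow_nonneg (a := frameOperator f) (y := -(1 / 2)))).isSymmetric x y

/-- `S^{-1/2} S^{-1/2} S = 1`. -/
theorem frameOperatorInvSqrt_frameOperatorInvSqrt_frameOperator {f : I → H} (hf : IsFrame f)
    (x : H) : frameOperatorInvSqrt f (frameOperatorInvSqrt f (frameOperator f x)) = x := by
  have hS := hf.isStrictlyPositive_frameOperator
  have h : frameOperator f ^ (-(1 / 2) : ℝ) * (frameOperator f ^ (-(1 / 2) : ℝ) *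
      frameOperator f) = 1 := by
    conv_lhs =>
      rw [← mul_assoc, ← CFC.rpow_add hS.isUnit]
      enter [2]
      rw [← CFC.rpow_one (frameOperator f)]
    rw [← CFC.rpow_add hS.isUnit]
    norm_num
    exact CFC.rpow_zero _
  exact congrArg (fun T : H →L[ℂ] H => T x) h

/-- `S^{-1/2} S S^{-1/2} = 1`. -/
theorem frameOperatorInvSqrt_frameOperator_frameOperatorInvSqrt {f : I → H} (hf : IsFrame f)
    (x : H) : frameOperatorInvSqrt f (frameOperator f (frameOperatorInvSqrt f x)) = x := by
  have hS := hf.isStrictlyPositive_frameOperator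
  have h : frameOperator f ^ (-(1 / 2) : ℝ) * (frameOperator f *
      frameOperator f ^ (-(1 / 2) : ℝ)) = 1 := by
    conv_lhs =>
      enter [2, 1]
      rw [← CFC.rpow_one (frameOperator f)]
    rw [← CFC.rpow_add hS.isUnit, ← CFC.rpow_add hS.isUnit]
    norm_num
    exact CFC.rpow_zero _
  exact congrArg (fun T : H →L[ℂ] H => T x) h

theorem norm_sq_frameOperatorInvSqrt_frameOperator {f : I → H} (hf : IsFrame f) (x : H) :
    ‖frameOperatorInvSqrt f (frameOperator f x)‖ ^ 2 = (inner ℂ (frameOperator f x) x).re := by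
  rw [← inner_self_eq_norm_sq (𝕜 := ℂ), inner_frameOperatorInvSqrt_left,
    frameOperatorInvSqrt_frameOperatorInvSqrt_frameOperator hf]
  rfl

/-- Applying `S^{-1/2}` to an R-dual of type II turns it into a family of unit vectors: the
coefficients of `S^{-1/2} ωⱼ` in the basis `h` are `⟨fᵢ, S^{-1/2} eⱼ⟩`, whose squares sum to
`⟨S S^{-1/2} eⱼ, S^{-1/2} eⱼ⟩ = ‖eⱼ‖²`. -/
theorem IsRDualTypeII.norm_frameOperatorInvSqrt_eq_one {f ω : I → H} (h : IsRDualTypeII f ω)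
    (j : I) : ‖frameOperatorInvSqrt f (ω j)‖ = 1 := by
  obtain ⟨hf, e, u, hω⟩ := h
  have h1 := (hω j).mapL (frameOperatorInvSqrt f)
  simp only [map_smul, frameOperatorInvSqrt_comp_frameOperatorSqrt hf] at h1
  set v := frameOperatorInvSqrt f (e j) with hv
  have hcoef : ∀ i, inner ℂ (u i) (frameOperatorInvSqrt f (ω j)) = inner ℂ v (f i) := by
    classical
    intro i
    have h2 := h1.mapL (innerSL ℂ (u i))
    refine h2.unique ((hasSum_ite_eq i (inner ℂ v (f i))).congr_fun fun k => ?_)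
    rw [innerSL_apply_apply, inner_smul_right, orthonormal_iff_ite.1 u.orthonormal]
    split_ifs with h3 h4 h4
    · rw [mul_one, h3]
    · exact absurd h3.symm h4
    · exact absurd h4.symm h3
    · exact mul_zero _
  have h3 : ‖frameOperatorInvSqrt f (ω j)‖ ^ 2 = ∑' i, ‖inner ℂ (f i) v‖ ^ 2 := by
    have h4 := (u.hasSum_inner_mul_inner (frameOperatorInvSqrt f (ω j))
      (frameOperatorInvSqrt f (ω j))).mapL Complex.reCLM
    rw [Complex.reCLM_apply] at h4
    rw [← inner_self_eq_norm_sq (𝕜 := ℂ)]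
    refine (h4.congr_fun fun i => ?_).tsum_eq.symm
    rw [hcoef, ← inner_conj_symm _ (u i), hcoef, ← inner_conj_symm v (f i),
      Complex.conj_conj, Complex.reCLM_apply, Complex.mul_conj, Complex.ofReal_re,
      Complex.normSq_eq_norm_sq]
  have h5 : ((‖frameOperatorInvSqrt f (ω j)‖ ^ 2 : ℝ) : ℂ) = 1 := by
    rw [h3, ← inner_frameOperator_self hf.isBessel, hv, ← inner_frameOperatorInvSqrt_left,
      frameOperatorInvSqrt_frameOperator_frameOperatorInvSqrt hf, inner_self_eq_norm_sq_to_K,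
      e.orthonormal.norm_eq_one]
    simp
  exact (pow_eq_one_iff_of_nonneg (norm_nonneg _) two_ne_zero).1 (by exact_mod_cast h5)

end FrameOperator

/-! ### The hat function and its square periodization -/

section Periodization

theorem continuous_hat : Continuous hat := by
  have : hat = fun x => max 0 (1 - |x|) := funext hat_eq
  rw [this]
  fun_prop

theorem hat_nonneg (x : ℝ) : 0 ≤ hat x := by
  rw [hat_eq]
  exact le_max_left _ _

theorem hat_le_one (x : ℝ) : hat x ≤ 1 := by
  rw [hat_eq]
  exact max_le zero_le_one (by linarith [abs_nonneg x])

theorem hat_eq_zero {x : ℝ} (hx : 1 ≤ |x|) : hat x = 0 := by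
  rw [hat_eq]
  exact max_eq_left (by linarith)

theorem hat_of_nonneg {x : ℝ} (h0 : 0 ≤ x) (h1 : x ≤ 1) : hat x = 1 - x := by
  rw [hat_eq, abs_of_nonneg h0]
  exact max_eq_right (by linarith)

theorem hat_of_nonpos {x : ℝ} (h0 : x ≤ 0) (h1 : -1 ≤ x) : hat x = 1 + x := by
  rw [hat_eq, abs_of_nonpos h0, max_eq_right] <;> linarith

/-- The periodization `G(x) = ∑ₙ hat(x - n)²` in closed form (see `hasSum_hat_sq`): only the two
translates centred at the end points of the unit interval around `x` contribute. -/
noncomputable def hatSum (x : ℝ) : ℝ := (1 - Int.fract x) ^ 2 + Int.fract x ^ 2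

theorem hasSum_hat_sq (x : ℝ) : HasSum (fun n : ℤ => hat (x - n) ^ 2) (hatSum x) := by
  have h0 := Int.fract_nonneg x
  have h1 := (Int.fract_lt_one x).le
  have hx := Int.floor_add_fract x
  have h : HasSum (fun n : ℤ => hat (x - n) ^ 2) (∑ n ∈ {⌊x⌋, ⌊x⌋ + 1}, hat (x - (n : ℤ)) ^ 2) :=
    hasSum_sum_of_ne_finset_zero (s := {⌊x⌋, ⌊x⌋ + 1})
    (f := fun n : ℤ => hat (x - n) ^ 2) fun n hn => by
      simp only [Finset.mem_insert, Finset.mem_singleton, not_or] at hn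
      rw [hat_eq_zero, zero_pow two_ne_zero]
      rcases lt_or_gt_of_ne hn.1 with h | h
      · have : (n : ℝ) + 1 ≤ ⌊x⌋ := by exact_mod_cast h
        rw [le_abs]
        left; linarith
      · have : (⌊x⌋ : ℝ) + 2 ≤ n := by exact_mod_cast (by omega : ⌊x⌋ + 2 ≤ n)
        rw [le_abs]
        right; linarith
  rw [Finset.sum_pair (by simp)] at h
  convert h using 1
  rw [hatSum, hat_of_nonneg (x := x - ⌊x⌋) (by linarith) (by linarith),
    hat_of_nonpos (x := x - (⌊x⌋ + 1 : ℤ)) (by push_cast; linarith) (by push_cast; linarith)]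
  push_cast
  rw [Int.fract]
  ring

theorem hatSum_le_one (x : ℝ) : hatSum x ≤ 1 := by
  have h0 := Int.fract_nonneg x
  have h1 := (Int.fract_lt_one x).le
  unfold hatSum
  nlinarith

theorem half_le_hatSum (x : ℝ) : 1 / 2 ≤ hatSum x := by
  unfold hatSum
  nlinarith [sq_nonneg (2 * Int.fract x - 1)]

theorem hatSum_pos (x : ℝ) : 0 < hatSum x := by linarith [half_le_hatSum x]

theorem measurable_hatSum : Measurable hatSum := by
  unfold hatSum
  fun_prop

end Periodization

/-! ### Parseval's identity on the line -/

section Parseval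

/-- Parseval's identity for a square integrable function supported in an interval of length `1/b`,
with the Fourier coefficients written as integrals over the line. -/
theorem hasSum_norm_sq_integral_exp {F : ℝ → ℂ} (hF : MemLp F 2 volume) {b : ℝ} (hb : 0 < b)
    (c : ℝ) (hsupp : ∀ x ∉ Set.Ioc c (c + b⁻¹), F x = 0) :
    HasSum (fun m : ℤ => ‖∫ x : ℝ, (starRingEnd ℂ)
        (Complex.exp (2 * Real.pi * Complex.I * (m * b : ℝ) * x)) * F x‖ ^ 2)
      (b⁻¹ * ∫ x, ‖F x‖ ^ 2) := by
  have hc : c < c + b⁻¹ := lt_add_of_pos_right _ (inv_pos.2 hb)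
  have h := (hasSum_sq_fourierCoeffOn hc (hF.restrict _)).mul_left (b⁻¹ ^ 2)
  have hrestr : ∀ {E : Type} [NormedAddCommGroup E] [NormedSpace ℝ E] (u : ℝ → E),
      (∀ x ∉ Set.Ioc c (c + b⁻¹), u x = 0) → ∫ x in c..c + b⁻¹, u x = ∫ x, u x := by
    intro E _ _ u hu
    rw [intervalIntegral.integral_of_le hc.le]
    exact setIntegral_eq_integral_of_forall_compl_eq_zero hu
  have hval : b⁻¹ ^ 2 * (c + b⁻¹ - c)⁻¹ • ∫ x in c..c + b⁻¹, ‖F x‖ ^ 2 =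
      b⁻¹ * ∫ x, ‖F x‖ ^ 2 := by
    rw [hrestr (fun x => ‖F x‖ ^ 2) fun x hx => by simp [hsupp x hx], add_sub_cancel_left,
      inv_inv, smul_eq_mul]
    field_simp
  rw [hval] at h
  refine h.congr_fun fun m => ?_
  rw [fourierCoeffOn_eq_integral, hrestr _ fun x hx => by simp [hsupp x hx], norm_smul, mul_pow,
    ← mul_assoc]
  have h1 : b⁻¹ ^ 2 * ‖1 / (c + b⁻¹ - c)‖ ^ 2 = 1 := by
    rw [add_sub_cancel_left, Real.norm_of_nonneg (by positivity)]
    field_simp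
  rw [h1, one_mul]
  congr 3
  funext x
  rw [fourier_coe_apply, smul_eq_mul, ← Complex.exp_conj]
  congr 2
  simp only [add_sub_cancel_left, map_mul, Complex.conj_I, Complex.conj_ofReal, map_ofNat]
  push_cast
  field_simp

end Parseval

/-! ### The Gabor frame of the hat function and its frame operator -/

section Frame

/-- A representative of an element of a Gabor system in terms of one of the window. -/
theorem coeFn_gaborSystem (a b : ℝ) {g : ℝ → ℂ} (hg : MemLp g 2 volume) (k : ℤ × ℤ) :
    gaborSystem a b (hg.toLp g) k =ᵐ[volume] fun x =>
      Complex.exp (2 * Real.pi * Complex.I * (k.1 * b : ℝ) * x) * g (x - k.2 * a) := by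
  have hmp := measurePreserving_sub_right (volume : Measure ℝ) (k.2 * a)
  have h1 := MemLp.coeFn_toLp (memLp_modulation (k.1 * b) (translation (k.2 * a) (hg.toLp g)))
  have h2 := Lp.coeFn_compMeasurePreserving (hg.toLp g) hmp
  have h3 := hmp.quasiMeasurePreserving.ae_eq_comp hg.coeFn_toLp
  filter_upwards [h1, h2, h3] with x h1 h2 h3
  rw [gaborSystem, modulation, h1, translation, h2, h3]
  rfl

theorem memLp_mul_of_bounded {u : ℝ → ℝ} (hu : Measurable u) {C : ℝ} (hC : ∀ x, ‖u x‖ ≤ C)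
    (f : L2R) : MemLp (fun x => (u x : ℂ) * f x) 2 volume := by
  refine (Lp.memLp f).of_le_mul (c := C) ?_ ?_
  · exact (Complex.measurable_ofReal.comp hu).aestronglyMeasurable.mul (Lp.aestronglyMeasurable f)
  · refine Filter.Eventually.of_forall fun x => ?_
    rw [norm_mul, Complex.norm_real]
    exact mul_le_mul_of_nonneg_right (hC x) (norm_nonneg _)

theorem memLp_hat_mul (t : ℝ) (f : L2R) :
    MemLp (fun x => (hat (x - t) : ℂ) * f x) 2 volume :=
  memLp_mul_of_bounded (by have := continuous_hat.measurable; fun_prop)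
    (fun x => by rw [Real.norm_of_nonneg (hat_nonneg _)]; exact hat_le_one _) f

theorem integrable_norm_sq (f : L2R) : Integrable (fun x => ‖f x‖ ^ 2) volume :=
  (memLp_two_iff_integrable_sq_norm (Lp.aestronglyMeasurable f)).1 (Lp.memLp f)

theorem norm_sq_eq_integral (f : L2R) : ‖f‖ ^ 2 = ∫ x, ‖f x‖ ^ 2 := by
  rw [← inner_self_eq_norm_sq (𝕜 := ℂ), L2.inner_def]
  simp only [inner_self_eq_norm_sq_to_K]
  norm_cast

theorem inner_gaborSystem_hatL2 (f : L2R) (b : ℝ) (m n : ℤ) :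
    inner ℂ (gaborSystem 1 b hatL2 (m, n)) f = ∫ x : ℝ, (starRingEnd ℂ)
        (Complex.exp (2 * Real.pi * Complex.I * (m * b : ℝ) * x)) * ((hat (x - n) : ℂ) * f x) := by
  rw [L2.inner_def]
  refine integral_congr_ae ?_
  filter_upwards [coeFn_gaborSystem 1 b memLp_hat (m, n)] with x hx
  rw [hatL2, hx, RCLike.inner_apply, map_mul, Complex.conj_ofReal, mul_one]
  ring

/-- For fixed `n`, the products with `E_{mb} T_n hat` are Fourier coefficients of
`x ↦ hat(x - n) f(x)` on an interval of length `1/b = 5/2` that contains the support of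
`hat(x - n)`. -/
theorem hasSum_norm_sq_inner_gaborSystem_fiber (f : L2R) (n : ℤ) :
    HasSum (fun m : ℤ => ‖inner ℂ (gaborSystem 1 (2 / 5) hatL2 (m, n)) f‖ ^ 2)
      (5 / 2 * ∫ x, hat (x - n) ^ 2 * ‖f x‖ ^ 2) := by
  have h := hasSum_norm_sq_integral_exp (memLp_hat_mul n f) (b := 2 / 5) (by norm_num) (n - 1)
    fun x hx => by
      rw [hat_eq_zero, Complex.ofReal_zero, zero_mul]
      by_contra! hlt
      have := abs_lt.1 hlt
      exact hx ⟨by linarith, by norm_num; linarith⟩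
  convert h using 1
  · simp only [inner_gaborSystem_hatL2]
  · norm_num [mul_pow, Complex.norm_real]

theorem integrable_hatSum_mul (f : L2R) :
    Integrable (fun x => hatSum x * ‖f x‖ ^ 2) volume := by
  refine (integrable_norm_sq f).bdd_mul (c := 1) measurable_hatSum.aestronglyMeasurable ?_
  refine Filter.Eventually.of_forall fun x => ?_
  rw [Real.norm_of_nonneg (hatSum_pos x).le]
  exact hatSum_le_one x

theorem hasSum_integral_hat_sq (f : L2R) :
    HasSum (fun n : ℤ => ∫ x, hat (x - n) ^ 2 * ‖f x‖ ^ 2) (∫ x, hatSum x * ‖f x‖ ^ 2) := by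
  have hm := (Lp.aestronglyMeasurable f).norm.pow 2
  have hsum : ∀ x, HasSum (fun n : ℤ => hat (x - n) ^ 2 * ‖f x‖ ^ 2) (hatSum x * ‖f x‖ ^ 2) :=
    fun x => (hasSum_hat_sq x).mul_right _
  refine hasSum_integral_of_dominated_convergence (fun n x => hat (x - n) ^ 2 * ‖f x‖ ^ 2)
    (fun n => ?_) (fun n => ?_) ?_ ?_ ?_
  · have := continuous_hat
    exact (by fun_prop : Continuous fun x : ℝ => hat (x - n) ^ 2).aestronglyMeasurable.mul hm
  · exact Filter.Eventually.of_forall fun x => (Real.norm_of_nonneg (by positivity)).le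
  · exact Filter.Eventually.of_forall fun x => (hsum x).summable
  · simpa only [(hsum _).tsum_eq] using integrable_hatSum_mul f
  · exact Filter.Eventually.of_forall hsum

/-- `∑_{m,n} |⟨f, E_{mb} T_{na} hat⟩|² = (1/b) ∫ G |f|²` for `a = 1`, `b = 2/5`. -/
theorem hasSum_norm_sq_inner_gaborSystem (f : L2R) :
    HasSum (fun k : ℤ × ℤ => ‖inner ℂ (gaborSystem 1 (2 / 5) hatL2 k) f‖ ^ 2)
      (5 / 2 * ∫ x, hatSum x * ‖f x‖ ^ 2) := by
  have h1 := hasSum_norm_sq_inner_gaborSystem_fiber f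
  have h2 := (hasSum_integral_hat_sq f).mul_left (5 / 2)
  rw [← (Equiv.prodComm ℤ ℤ).hasSum_iff]
  set u : ℤ × ℤ → ℝ := (fun k : ℤ × ℤ => ‖inner ℂ (gaborSystem 1 (2 / 5) hatL2 k) f‖ ^ 2) ∘
    Equiv.prodComm ℤ ℤ
  have hs : Summable u := by
    rw [summable_prod_of_nonneg fun k => by simp only [u, Function.comp]; positivity]
    refine ⟨fun n => (h1 n).summable, ?_⟩
    exact h2.summable.congr fun n => (h1 n).tsum_eq.symm
  have h3 := hs.hasSum.prod_fiberwise h1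
  rw [h2.unique h3]
  exact hs.hasSum

/-- The bounds come from `1/2 ≤ G ≤ 1`. -/
theorem hasFrameBounds_gaborSystem :
    HasFrameBounds (gaborSystem 1 (2 / 5) hatL2) (5 / 4) (5 / 2) := by
  refine ⟨by norm_num, by norm_num, fun f => ?_⟩
  have h := hasSum_norm_sq_inner_gaborSystem f
  have hf := integrable_norm_sq f
  have hG := integrable_hatSum_mul f
  refine ⟨h.summable, ?_, ?_⟩
  · rw [h.tsum_eq, norm_sq_eq_integral]
    have := integral_mono (hf.const_mul (1 / 2)) hG fun x =>
      mul_le_mul_of_nonneg_right (half_le_hatSum x) (sq_nonneg ‖f x‖)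
    rw [integral_const_mul] at this
    linarith
  · rw [h.tsum_eq, norm_sq_eq_integral]
    have := integral_mono hG hf fun x =>
      mul_le_of_le_one_left (sq_nonneg ‖f x‖) (hatSum_le_one x)
    linarith

theorem memLp_hatSum_mul (f : L2R) :
    MemLp (fun x => ((5 / 2 * hatSum x : ℝ) : ℂ) * f x) 2 volume :=
  memLp_mul_of_bounded (u := fun x => 5 / 2 * hatSum x) (C := 5 / 2)
    (measurable_hatSum.const_mul _) (fun x => by
      rw [Real.norm_of_nonneg (by have := hatSum_pos x; positivity)]
      linarith [hatSum_le_one x]) f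

/-- Multiplication by the bounded function `(5/2) G` on `L²(ℝ)`. -/
noncomputable def hatSumMul : L2R →ₗ[ℂ] L2R where
  toFun f := (memLp_hatSum_mul f).toLp _
  map_add' f g := by
    rw [← MemLp.toLp_add]
    refine MemLp.toLp_congr _ _ ?_
    filter_upwards [Lp.coeFn_add f g] with x hx
    rw [hx]
    simp [mul_add]
  map_smul' c f := by
    rw [RingHom.id_apply, ← MemLp.toLp_const_smul]
    refine MemLp.toLp_congr _ _ ?_
    filter_upwards [Lp.coeFn_smul c f] with x hx
    rw [hx]
    simp [mul_left_comm]

theorem coeFn_hatSumMul (f : L2R) :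
    hatSumMul f =ᵐ[volume] fun x => ((5 / 2 * hatSum x : ℝ) : ℂ) * f x :=
  MemLp.coeFn_toLp (memLp_hatSum_mul f)

theorem frameOperator_gaborSystem (f : L2R) :
    frameOperator (gaborSystem 1 (2 / 5) hatL2) f = hatSumMul f := by
  have hB : IsBessel (gaborSystem 1 (2 / 5) hatL2) :=
    IsFrame.isBessel ⟨_, _, hasFrameBounds_gaborSystem⟩
  refine frameOperator_eq_of_inner_self hB hatSumMul (fun f => ?_) f
  rw [(hasSum_norm_sq_inner_gaborSystem f).tsum_eq, L2.inner_def, ← integral_const_mul,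
    ← integral_complex_ofReal]
  refine integral_congr_ae ?_
  filter_upwards [coeFn_hatSumMul f] with x hx
  rw [hx, RCLike.inner_apply, map_mul, Complex.conj_ofReal, mul_left_comm, Complex.mul_conj,
    Complex.normSq_eq_norm_sq]
  push_cast
  ring

end Frame

/-! ### The adjoint Gabor system is a Riesz sequence -/

section Riesz

theorem norm_sq_sum_of_pairwise_inner_eq_zero {ι H : Type*} [NormedAddCommGroup H]
    [InnerProductSpace ℂ H] (s : Finset ι) (v : ι → H)
    (hv : ∀ i j, i ≠ j → inner ℂ (v i) (v j) = 0) :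
    ‖∑ i ∈ s, v i‖ ^ 2 = ∑ i ∈ s, ‖v i‖ ^ 2 := by
  have h : inner ℂ (∑ i ∈ s, v i) (∑ i ∈ s, v i) = ∑ i ∈ s, inner ℂ (v i) (v i) := by
    rw [sum_inner]
    refine Finset.sum_congr rfl fun i hi => ?_
    rw [inner_sum]
    exact Finset.sum_eq_single_of_mem i hi fun j _ hj => hv i j hj.symm
  have h2 := congrArg Complex.re h
  simp only [inner_self_eq_norm_sq_to_K] at h2
  norm_cast at h2

/-- The exponential sum `∑ₘ cₘ e^{2πimx}`; the factor `m * 1` is the frequency `m b` of a Gabor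
system with `b = 1`. -/
noncomputable def trigSum (A : Finset ℤ) (c : ℤ → ℂ) (x : ℝ) : ℂ :=
  ∑ m ∈ A, c m * Complex.exp (2 * Real.pi * Complex.I * (m * 1 : ℝ) * x)

theorem continuous_trigSum (A : Finset ℤ) (c : ℤ → ℂ) : Continuous (trigSum A c) := by
  unfold trigSum
  fun_prop

theorem trigSum_sub_one (A : Finset ℤ) (c : ℤ → ℂ) (x : ℝ) :
    trigSum A c (x - 1) = trigSum A c x := by
  refine Finset.sum_congr rfl fun m _ => ?_
  congr 1
  have : 2 * Real.pi * Complex.I * (m * 1 : ℝ) * x =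
      2 * Real.pi * Complex.I * (m * 1 : ℝ) * (x - 1 : ℝ) + m * (2 * Real.pi * Complex.I) := by
    push_cast
    ring
  rw [this, Complex.exp_add, Complex.exp_int_mul_two_pi_mul_I]
  exact (mul_one _).symm

theorem integral_exp_int (t : ℝ) (k : ℤ) :
    ∫ x in t..t + 1, Complex.exp (2 * Real.pi * Complex.I * k * x) = if k = 0 then 1 else 0 := by
  split_ifs with hk
  · simp [hk]
  · have hne : (2 * Real.pi * Complex.I * k : ℂ) ≠ 0 :=
      mul_ne_zero Complex.two_pi_I_ne_zero (by exact_mod_cast hk)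
    rw [integral_exp_mul_complex hne]
    have : (2 * Real.pi * Complex.I * k * (t + 1 : ℝ) : ℂ) =
        2 * Real.pi * Complex.I * k * t + k * (2 * Real.pi * Complex.I) := by
      push_cast
      ring
    rw [this, Complex.exp_add, Complex.exp_int_mul_two_pi_mul_I, mul_one, sub_self, zero_div]

theorem integral_norm_sq_trigSum (A : Finset ℤ) (c : ℤ → ℂ) (t : ℝ) :
    ∫ x in t..t + 1, ‖trigSum A c x‖ ^ 2 = ∑ m ∈ A, ‖c m‖ ^ 2 := by
  have h1 : ∀ x : ℝ, ((‖trigSum A c x‖ ^ 2 : ℝ) : ℂ) = ∑ m ∈ A, ∑ l ∈ A,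
      c m * (starRingEnd ℂ) (c l) *
        Complex.exp (2 * Real.pi * Complex.I * (m - l : ℤ) * x) := by
    intro x
    rw [← Complex.normSq_eq_norm_sq, ← Complex.mul_conj, trigSum, map_sum, Finset.sum_mul_sum]
    refine Finset.sum_congr rfl fun m _ => Finset.sum_congr rfl fun l _ => ?_
    rw [map_mul, ← Complex.exp_conj, mul_mul_mul_comm, ← Complex.exp_add]
    congr 2
    simp only [map_mul, Complex.conj_I, Complex.conj_ofReal, map_ofNat]
    push_cast
    ring
  apply Complex.ofReal_injective
  rw [← intervalIntegral.integral_ofReal]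
  simp only [h1]
  rw [intervalIntegral.integral_finsetSum fun m _ => Continuous.intervalIntegrable
    (by fun_prop) _ _, Complex.ofReal_sum]
  refine Finset.sum_congr rfl fun m hm => ?_
  rw [intervalIntegral.integral_finsetSum fun l _ => Continuous.intervalIntegrable
    (by fun_prop) _ _]
  simp only [intervalIntegral.integral_const_mul, integral_exp_int]
  rw [Finset.sum_eq_single_of_mem m hm fun l _ hl => by
    rw [if_neg (sub_ne_zero.2 hl.symm), mul_zero]]
  rw [sub_self, if_pos rfl, mul_one, Complex.mul_conj, Complex.normSq_eq_norm_sq]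

/-- Folding the two halves of the support of `hat(x - t)` onto one period of the exponential sum
replaces the weight `hat²` by `(1 - y)² + y²`, which lies between `1/2` and `1`. -/
theorem integral_norm_sq_trigSum_mul_hat (A : Finset ℤ) (c : ℤ → ℂ) (t : ℝ) :
    ∫ x, ‖trigSum A c x * hat (x - t)‖ ^ 2 =
      ∫ x in t..t + 1, ((1 - (x - t)) ^ 2 + (x - t) ^ 2) * ‖trigSum A c x‖ ^ 2 := by
  have hP := continuous_trigSum A c
  have hh := continuous_hat
  have hc : Continuous fun x => ‖trigSum A c x * hat (x - t)‖ ^ 2 := by fun_prop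
  have h0 : ∫ x, ‖trigSum A c x * hat (x - t)‖ ^ 2 =
      ∫ x in (t - 1)..(t + 1), ‖trigSum A c x * hat (x - t)‖ ^ 2 := by
    rw [intervalIntegral.integral_of_le (by linarith)]
    refine (setIntegral_eq_integral_of_forall_compl_eq_zero fun x hx => ?_).symm
    rw [hat_eq_zero, Complex.ofReal_zero, mul_zero, norm_zero, zero_pow two_ne_zero]
    by_contra! hlt
    have := abs_lt.1 hlt
    exact hx ⟨by linarith, by linarith⟩
  have h1 : ∫ x in (t - 1)..t, ‖trigSum A c x * hat (x - t)‖ ^ 2 =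
      ∫ x in t..t + 1, ‖trigSum A c x * hat (x - 1 - t)‖ ^ 2 := by
    have := intervalIntegral.integral_comp_sub_right (a := t) (b := t + 1)
      (fun x => ‖trigSum A c x * hat (x - t)‖ ^ 2) 1
    rw [add_sub_cancel_right] at this
    rw [← this]
    simp only [trigSum_sub_one]
  rw [h0, ← intervalIntegral.integral_add_adjacent_intervals (b := t)
    (hc.intervalIntegrable _ _) (hc.intervalIntegrable _ _), h1,
    ← intervalIntegral.integral_add (Continuous.intervalIntegrable (by fun_prop) _ _)
    (hc.intervalIntegrable _ _)]
  refine intervalIntegral.integral_congr fun x hx => ?_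
  rw [Set.uIcc_of_le (by linarith)] at hx
  obtain ⟨hx1, hx2⟩ := hx
  simp only [norm_mul, Complex.norm_real, Real.norm_eq_abs, mul_pow, sq_abs]
  rw [hat_of_nonneg (x := x - t) (by linarith) (by linarith),
    hat_of_nonpos (x := x - 1 - t) (by linarith) (by linarith)]
  ring

theorem integral_norm_sq_trigSum_mul_hat_bounds (A : Finset ℤ) (c : ℤ → ℂ) (t : ℝ) :
    1 / 2 * ∑ m ∈ A, ‖c m‖ ^ 2 ≤ ∫ x, ‖trigSum A c x * hat (x - t)‖ ^ 2 ∧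
      ∫ x, ‖trigSum A c x * hat (x - t)‖ ^ 2 ≤ ∑ m ∈ A, ‖c m‖ ^ 2 := by
  have hP := continuous_trigSum A c
  rw [integral_norm_sq_trigSum_mul_hat, ← integral_norm_sq_trigSum A c t,
    ← intervalIntegral.integral_const_mul]
  constructor
  · refine intervalIntegral.integral_mono_on (by linarith)
      (Continuous.intervalIntegrable (by fun_prop) _ _)
      (Continuous.intervalIntegrable (by fun_prop) _ _) fun x _ => ?_
    exact mul_le_mul_of_nonneg_right (by nlinarith [sq_nonneg (2 * (x - t) - 1)]) (sq_nonneg _)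
  · refine intervalIntegral.integral_mono_on (by linarith)
      (Continuous.intervalIntegrable (by fun_prop) _ _)
      (Continuous.intervalIntegrable (by fun_prop) _ _) fun x hx => ?_
    exact mul_le_of_le_one_left (sq_nonneg _) (by nlinarith [hx.1, hx.2])

theorem coeFn_sum_gaborSystem (a : ℝ) (A : Finset ℤ) (c : ℤ → ℂ) (n : ℤ) :
    ((∑ m ∈ A, c m • gaborSystem a 1 hatL2 (m, n) : L2R) : ℝ → ℂ) =ᵐ[volume]
      fun x => trigSum A c x * hat (x - n * a) := by
  have h1 := Lp.coeFn_finsetSum A fun m => c m • gaborSystem a 1 hatL2 (m, n)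
  have h2 : ∀ m : ℤ, _ := fun m => Lp.coeFn_smul (c m) (gaborSystem a 1 hatL2 (m, n))
  have h3 : ∀ m : ℤ, _ := fun m => coeFn_gaborSystem a 1 memLp_hat (m, n)
  filter_upwards [h1, ae_all_iff.2 h2, ae_all_iff.2 h3] with x h1 h2 h3
  rw [h1, trigSum, Finset.sum_mul, Finset.sum_apply]
  refine Finset.sum_congr rfl fun m _ => ?_
  rw [h2, Pi.smul_apply, hatL2, h3, smul_eq_mul, ← mul_assoc]

/-- If the translates `hat(x - na)` have disjoint supports, then the integer modulations of them
form a Riesz sequence. -/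
theorem hasRieszBounds_gaborSystem {a : ℝ} (ha : 2 ≤ a) :
    HasRieszBounds (gaborSystem a 1 hatL2) (1 / 2) 1 := by
  classical
  refine ⟨by norm_num, by norm_num, fun s c₀ => ?_⟩
  -- Extending the coefficients by zero, the sum runs over a product `A ×ˢ N`.
  set c : ℤ × ℤ → ℂ := fun k => if k ∈ s then c₀ k else 0 with hc
  set A := s.image Prod.fst
  set N := s.image Prod.snd
  have hs : s ⊆ A ×ˢ N := fun k hk =>
    Finset.mem_product.2 ⟨Finset.mem_image_of_mem _ hk, Finset.mem_image_of_mem _ hk⟩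
  set v : ℤ → L2R := fun n => ∑ m ∈ A, c (m, n) • gaborSystem a 1 hatL2 (m, n) with hv
  have hsum : ∑ k ∈ s, c₀ k • gaborSystem a 1 hatL2 k = ∑ n ∈ N, v n := by
    rw [← Finset.sum_product_right (f := fun k => c k • gaborSystem a 1 hatL2 k),
      ← Finset.sum_subset hs fun k _ hk => by simp [hc, hk]]
    exact Finset.sum_congr rfl fun k hk => by simp [hc, hk]
  have hsq : ∑ k ∈ s, ‖c₀ k‖ ^ 2 = ∑ n ∈ N, ∑ m ∈ A, ‖c (m, n)‖ ^ 2 := by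
    rw [← Finset.sum_product_right (f := fun k => ‖c k‖ ^ 2),
      ← Finset.sum_subset hs fun k _ hk => by simp [hc, hk]]
    exact Finset.sum_congr rfl fun k hk => by simp [hc, hk]
  have hcoe : ∀ n, (v n : ℝ → ℂ) =ᵐ[volume]
      fun x => trigSum A (fun m => c (m, n)) x * hat (x - n * a) :=
    fun n => coeFn_sum_gaborSystem a A (fun m => c (m, n)) n
  have horth : ∀ i j, i ≠ j → inner ℂ (v i) (v j) = 0 := by
    intro i j hij
    rw [L2.inner_def]
    refine integral_eq_zero_of_ae ?_
    filter_upwards [hcoe i, hcoe j] with x hi hj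
    rw [hi, hj, RCLike.inner_apply, Pi.zero_apply]
    have habs : (1 : ℝ) ≤ |(i : ℝ) - j| := by
      exact_mod_cast Int.one_le_abs (sub_ne_zero.2 hij)
    have : 1 ≤ |x - i * a| ∨ 1 ≤ |x - j * a| := by
      by_contra! h
      have h3 : |((i : ℝ) - j) * a| < 2 := by
        have h4 := abs_lt.1 h.1
        have h5 := abs_lt.1 h.2
        rw [abs_lt]
        constructor <;> linarith
      rw [abs_mul, abs_of_pos (by linarith : 0 < a)] at h3
      nlinarith
    rcases this with h | h
    · simp [hat_eq_zero h]
    · simp [hat_eq_zero h]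
  have hnorm : ∀ n, ‖v n‖ ^ 2 =
      ∫ x, ‖trigSum A (fun m => c (m, n)) x * hat (x - n * a)‖ ^ 2 := by
    intro n
    rw [norm_sq_eq_integral]
    refine integral_congr_ae ?_
    filter_upwards [hcoe n] with x hx
    rw [hx]
  rw [hsum, hsq, norm_sq_sum_of_pairwise_inner_eq_zero N v horth, one_mul, Finset.mul_sum]
  simp only [hnorm]
  exact ⟨Finset.sum_le_sum fun n _ => (integral_norm_sq_trigSum_mul_hat_bounds A _ _).1,
    Finset.sum_le_sum fun n _ => (integral_norm_sq_trigSum_mul_hat_bounds A _ _).2⟩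

theorem HasRieszBounds.const_smul {I H : Type*} [NormedAddCommGroup H] [InnerProductSpace ℂ H]
    {f : I → H} {A B : ℝ} (hf : HasRieszBounds f A B) {r : ℂ} (hr : r ≠ 0) :
    HasRieszBounds (fun i => r • f i) (‖r‖ ^ 2 * A) (‖r‖ ^ 2 * B) := by
  obtain ⟨hA, hAB, h⟩ := hf
  have hr' : 0 < ‖r‖ ^ 2 := by positivity
  refine ⟨mul_pos hr' hA, mul_le_mul_of_nonneg_left hAB hr'.le, fun s c => ?_⟩
  have : ∑ i ∈ s, c i • r • f i = r • ∑ i ∈ s, c i • f i := by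
    rw [Finset.smul_sum]
    exact Finset.sum_congr rfl fun i _ => smul_comm _ _ _
  rw [this, norm_smul, mul_pow, mul_assoc, mul_assoc]
  exact ⟨mul_le_mul_of_nonneg_left (h s c).1 hr'.le, mul_le_mul_of_nonneg_left (h s c).2 hr'.le⟩

/-- The adjoint system is a multiple of the Gabor system with parameters `1/b`, `1/a`. -/
theorem adjointGaborSystem_eq (a b : ℝ) (g : L2R) (k : ℤ × ℤ) :
    adjointGaborSystem a b g k =
      ((1 / Real.sqrt (a * b) : ℝ) : ℂ) • gaborSystem b⁻¹ a⁻¹ g k := by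
  rw [adjointGaborSystem, gaborSystem, div_eq_mul_inv (k.1 : ℝ), div_eq_mul_inv (k.2 : ℝ)]

theorem isRieszSequence_adjointGaborSystem :
    IsRieszSequence (adjointGaborSystem 1 (2 / 5) hatL2) := by
  have h := (hasRieszBounds_gaborSystem (a := (2 / 5)⁻¹) (by norm_num)).const_smul
    (r := ((1 / Real.sqrt (1 * (2 / 5)) : ℝ) : ℂ)) (by
      rw [Complex.ofReal_ne_zero]
      positivity)
  have heq : adjointGaborSystem 1 (2 / 5) hatL2 = fun k =>
      ((1 / Real.sqrt (1 * (2 / 5)) : ℝ) : ℂ) • gaborSystem (2 / 5)⁻¹ 1 hatL2 k := by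
    funext k
    rw [adjointGaborSystem_eq, inv_one]
  exact ⟨_, _, heq ▸ h⟩

end Riesz

/-! ### The norm of `S^{-1/2} ω_{0,1}` -/

section NormComputation

theorem hatSum_eq_of_mem {x : ℝ} (n : ℤ) (h0 : n ≤ x) (h1 : x < n + 1) :
    hatSum x = (1 - (x - n)) ^ 2 + (x - n) ^ 2 := by
  have : Int.fract x = x - n := Int.fract_eq_iff.2 ⟨by linarith, by linarith, n, by ring⟩
  rw [hatSum, this]

theorem hatSum_sub_five_halves (x : ℝ) : hatSum (x - 5 / 2) = hatSum (x + 5 / 2) := by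
  have : x - 5 / 2 = x + 5 / 2 - (5 : ℕ) := by push_cast; ring
  rw [hatSum, this, Int.fract_sub_natCast, hatSum]

theorem hatSum_neg (x : ℝ) : hatSum (-x) = hatSum x := by
  by_cases h : Int.fract x = 0
  · rw [hatSum, hatSum, Int.fract_neg_eq_zero.2 h, h]
  · rw [hatSum, hatSum, Int.fract_neg h]
    ring

theorem integral_sq_div :
    ∫ x in (0 : ℝ)..1 / 2, x ^ 2 / (2 * x ^ 2 + 1 / 2) = 1 / 4 - Real.pi / 16 := by
  have hd : ∀ x ∈ Set.uIcc (0 : ℝ) (1 / 2),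
      HasDerivAt (fun x => x / 2 - Real.arctan (2 * x) / 4) (x ^ 2 / (2 * x ^ 2 + 1 / 2)) x := by
    intro x _
    have h0 : HasDerivAt (fun x : ℝ => 2 * x) 2 x := by
      simpa using (hasDerivAt_id x).const_mul 2
    have h1 := h0.arctan.div_const 4
    have h2 := ((hasDerivAt_id x).div_const 2).sub h1
    refine h2.congr_deriv ?_
    have : 2 * x ^ 2 + 1 / 2 ≠ 0 := by positivity
    have : 1 + (2 * x) ^ 2 ≠ 0 := by positivity
    field_simp
    ring
  rw [intervalIntegral.integral_eq_sub_of_hasDerivAt hd]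
  · norm_num
    ring
  · refine Continuous.intervalIntegrable
      (Continuous.div (by fun_prop) (by fun_prop) fun x => ?_) _ _
    positivity

theorem integral_one_sub_sq_div :
    ∫ x in (0 : ℝ)..1 / 2, (1 - x) ^ 2 / (2 * x ^ 2 + 1 / 2) =
      1 / 4 + 3 * Real.pi / 16 - Real.log 2 / 2 := by
  have hd : ∀ x ∈ Set.uIcc (0 : ℝ) (1 / 2),
      HasDerivAt (fun x => x / 2 + 3 / 4 * Real.arctan (2 * x) - 1 / 2 * Real.log (1 + (2 * x) ^ 2))
        ((1 - x) ^ 2 / (2 * x ^ 2 + 1 / 2)) x := by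
    intro x _
    have h0 : HasDerivAt (fun x : ℝ => 2 * x) 2 x := by
      simpa using (hasDerivAt_id x).const_mul 2
    have h1 := h0.arctan.const_mul (3 / 4)
    have hp : HasDerivAt (fun x : ℝ => 1 + (2 * x) ^ 2) (8 * x) x :=
      ((h0.pow 2).const_add 1).congr_deriv (by push_cast; ring)
    have h3 := (hp.log (by positivity)).const_mul (1 / 2)
    have h2 := (((hasDerivAt_id x).div_const 2).add h1).sub h3
    refine h2.congr_deriv ?_
    have : 2 * x ^ 2 + 1 / 2 ≠ 0 := by positivity
    have : 1 + (2 * x) ^ 2 ≠ 0 := by positivity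
    field_simp
    ring
  rw [intervalIntegral.integral_eq_sub_of_hasDerivAt hd]
  · norm_num
    ring
  · refine Continuous.intervalIntegrable
      (Continuous.div (by fun_prop) (by fun_prop) fun x => ?_) _ _
    positivity

/-- After centring at `5/2` the integrand is even, and `G(y + 5/2)` equals `2y² + 1/2` for
`0 ≤ y < 1/2` and `2(1 - y)² + 1/2` for `1/2 ≤ y ≤ 1`, which leaves two rational integrals. -/
theorem integral_hat_sq_div_hatSum :
    ∫ x, hat (x - 5 / 2) ^ 2 / hatSum x = 1 + Real.pi / 4 - Real.log 2 := by
  set φ : ℝ → ℝ := fun y => hat y ^ 2 / hatSum (y + 5 / 2) with hφ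
  have hh := continuous_hat
  have hmeas : Measurable φ := by
    have := measurable_hatSum
    have := hh.measurable
    fun_prop
  have hint : ∀ a b : ℝ, IntervalIntegrable φ volume a b := by
    intro a b
    refine (intervalIntegrable_const (c := (2 : ℝ))).mono_fun hmeas.aestronglyMeasurable ?_
    refine Filter.Eventually.of_forall fun y => ?_
    have h1 := half_le_hatSum (y + 5 / 2)
    have h2 := hatSum_pos (y + 5 / 2)
    have h3 := hat_nonneg y
    have h4 : 0 ≤ φ y := div_nonneg (sq_nonneg _) h2.le
    refine (Real.norm_of_nonneg h4).trans_le (le_trans ?_ (le_abs_self _))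
    simp only [hφ]
    rw [div_le_iff₀ h2]
    nlinarith [hat_le_one y]
  have heven : ∀ y, φ |y| = φ y := by
    intro y
    rcases abs_choice y with h | h
    · rw [h]
    · rw [h]
      simp only [hφ]
      rw [hat_eq, hat_eq, abs_neg, ← hatSum_sub_five_halves, ← hatSum_neg, neg_sub, sub_neg_eq_add,
        add_comm]
  have hsupp : ∫ y in Set.Ioi 0, φ y = ∫ y in (0 : ℝ)..1, φ y := by
    rw [intervalIntegral.integral_of_le zero_le_one]
    refine setIntegral_eq_of_subset_of_forall_sdiff_eq_zero measurableSet_Ioi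
      Set.Ioc_subset_Ioi_self fun y hy => ?_
    have : 1 ≤ |y| := by
      have h0 : 0 < y := hy.1
      rw [abs_of_pos h0]
      by_contra! h
      exact hy.2 ⟨h0, h.le⟩
    simp [hφ, hat_eq_zero this]
  have h1 : ∫ y in (0 : ℝ)..1 / 2, φ y =
      ∫ x in (0 : ℝ)..1 / 2, (1 - x) ^ 2 / (2 * x ^ 2 + 1 / 2) := by
    refine intervalIntegral.integral_congr_Ioo_of_le (by norm_num) fun y hy => ?_
    simp only [hφ]
    rw [hat_of_nonneg hy.1.le (by linarith [hy.2]),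
      hatSum_eq_of_mem 2 (by push_cast; linarith [hy.1]) (by push_cast; linarith [hy.2])]
    congr 1
    push_cast
    ring
  have h2 : ∫ y in (1 / 2 : ℝ)..1, φ y = ∫ x in (0 : ℝ)..1 / 2, x ^ 2 / (2 * x ^ 2 + 1 / 2) := by
    have := intervalIntegral.integral_comp_sub_left (a := 1 / 2) (b := 1)
      (fun x : ℝ => x ^ 2 / (2 * x ^ 2 + 1 / 2)) 1
    norm_num at this
    norm_num
    rw [← this]
    refine intervalIntegral.integral_congr_Ioo_of_le (by norm_num) fun y hy => ?_
    simp only [hφ]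
    rw [hat_of_nonneg (by linarith [hy.1]) hy.2.le,
      hatSum_eq_of_mem 3 (by push_cast; linarith [hy.1]) (by push_cast; linarith [hy.2])]
    congr 1
    push_cast
    ring
  calc ∫ x, hat (x - 5 / 2) ^ 2 / hatSum x
      = ∫ x, φ (x - 5 / 2) := by simp only [hφ, sub_add_cancel]
    _ = ∫ x, φ |x| := by rw [integral_sub_right_eq_self φ]; simp only [heven]
    _ = 2 * ((∫ y in (0 : ℝ)..1 / 2, φ y) + ∫ y in (1 / 2 : ℝ)..1, φ y) := by
      rw [integral_comp_abs, hsupp,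
        intervalIntegral.integral_add_adjacent_intervals (hint _ _) (hint _ _)]
    _ = 1 + Real.pi / 4 - Real.log 2 := by
      rw [h1, h2, integral_sq_div, integral_one_sub_sq_div]
      ring

theorem memLp_hatSum_inv_mul (f : L2R) :
    MemLp (fun x => (((5 / 2 * hatSum x)⁻¹ : ℝ) : ℂ) * f x) 2 volume :=
  memLp_mul_of_bounded (u := fun x => (5 / 2 * hatSum x)⁻¹) (C := 4 / 5)
    (measurable_hatSum.const_mul _).inv (fun x => by
      have := hatSum_pos x
      rw [Real.norm_of_nonneg (by positivity), inv_le_comm₀ (by positivity) (by norm_num)]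
      linarith [half_le_hatSum x]) f

/-- Here `‖S^{-1/2} f‖² = ⟨f, S⁻¹ f⟩`, and `S⁻¹` is division by `(5/2) G`. -/
theorem norm_sq_frameOperatorInvSqrt_gaborSystem (f : L2R) :
    ‖frameOperatorInvSqrt (gaborSystem 1 (2 / 5) hatL2) f‖ ^ 2 =
      ∫ x, (5 / 2 * hatSum x)⁻¹ * ‖f x‖ ^ 2 := by
  set η : L2R := (memLp_hatSum_inv_mul f).toLp _
  have hη : (η : ℝ → ℂ) =ᵐ[volume] fun x => (((5 / 2 * hatSum x)⁻¹ : ℝ) : ℂ) * f x :=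
    MemLp.coeFn_toLp _
  have hS : frameOperator (gaborSystem 1 (2 / 5) hatL2) η = f := by
    rw [frameOperator_gaborSystem]
    refine Lp.ext ?_
    filter_upwards [coeFn_hatSumMul η, hη] with x h1 h2
    have := (hatSum_pos x).ne'
    rw [h1, h2, ← mul_assoc, ← Complex.ofReal_mul, mul_inv_cancel₀ (by positivity),
      Complex.ofReal_one, one_mul]
  have h := norm_sq_frameOperatorInvSqrt_frameOperator
    (f := gaborSystem 1 (2 / 5) hatL2) ⟨_, _, hasFrameBounds_gaborSystem⟩ η
  rw [hS, L2.inner_def] at h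
  have h2 : ∫ x, inner ℂ (f x) (η x) = ((∫ x, (5 / 2 * hatSum x)⁻¹ * ‖f x‖ ^ 2 : ℝ) : ℂ) := by
    rw [← integral_complex_ofReal]
    refine integral_congr_ae ?_
    filter_upwards [hη] with x hx
    rw [hx, RCLike.inner_apply, mul_assoc, Complex.mul_conj, Complex.normSq_eq_norm_sq]
    push_cast
    rfl
  rw [h, h2, Complex.ofReal_re]

theorem norm_sq_frameOperatorInvSqrt_adjointGaborSystem :
    ‖frameOperatorInvSqrt (gaborSystem 1 (2 / 5) hatL2)
        (adjointGaborSystem 1 (2 / 5) hatL2 (0, 1))‖ ^ 2 = 1 + Real.pi / 4 - Real.log 2 := by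
  rw [norm_sq_frameOperatorInvSqrt_gaborSystem, ← integral_hat_sq_div_hatSum]
  refine integral_congr_ae ?_
  rw [adjointGaborSystem_eq]
  filter_upwards [Lp.coeFn_smul ((1 / Real.sqrt (1 * (2 / 5)) : ℝ) : ℂ)
    (gaborSystem (2 / 5)⁻¹ 1⁻¹ hatL2 (0, 1)), coeFn_gaborSystem (2 / 5)⁻¹ 1⁻¹ memLp_hat (0, 1)]
    with x h1 h2
  have hr : (1 / Real.sqrt (1 * (2 / 5))) ^ 2 = 5 / 2 := by
    rw [div_pow, Real.sq_sqrt (by norm_num)]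
    norm_num
  have hx : x - (1 : ℤ) * (2 / 5 : ℝ)⁻¹ = x - 5 / 2 := by norm_num
  have := (hatSum_pos x).ne'
  rw [h1, Pi.smul_apply, hatL2, h2, hx, Int.cast_zero, zero_mul, Complex.ofReal_zero, mul_zero,
    zero_mul, Complex.exp_zero, one_mul (hat (x - 5 / 2) : ℂ), smul_eq_mul, norm_mul,
    Complex.norm_real, Complex.norm_real, mul_pow, Real.norm_eq_abs, Real.norm_eq_abs, sq_abs, sq_abs, hr]
  field_simp

theorem one_add_pi_div_four_sub_log_two_ne_one : 1 + Real.pi / 4 - Real.log 2 ≠ 1 := by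
  have h1 := Real.pi_gt_three
  have h2 := Real.log_two_lt_d9
  linarith

theorem not_isRDualTypeII_adjointGaborSystem :
    ¬ IsRDualTypeII (gaborSystem 1 (2 / 5) hatL2) (adjointGaborSystem 1 (2 / 5) hatL2) := by
  intro h
  have h1 := norm_sq_frameOperatorInvSqrt_adjointGaborSystem
  rw [h.norm_frameOperatorInvSqrt_eq_one, one_pow] at h1
  exact one_add_pi_div_four_sub_log_two_ne_one h1.symm

end NormComputation

end RDual

theorem mainTheorem5 :
    IsFrame (gaborSystem 1 (2 / 5) hatL2) ∧
    IsRieszSequence (adjointGaborSystem 1 (2 / 5) hatL2) ∧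
    ‖frameOperatorInvSqrt (gaborSystem 1 (2 / 5) hatL2)
        (adjointGaborSystem 1 (2 / 5) hatL2 (0, 1))‖ ^ 2 = 1 + Real.pi / 4 - Real.log 2 ∧
    1 + Real.pi / 4 - Real.log 2 ≠ 1 ∧
    ¬ IsRDualTypeII (gaborSystem 1 (2 / 5) hatL2) (adjointGaborSystem 1 (2 / 5) hatL2) ∧
    ¬ (∀ (a b : ℝ) (g : L2R), 0 < a → 0 < b → IsFrame (gaborSystem a b g) →
        IsRDualTypeII (gaborSystem a b g) (adjointGaborSystem a b g)) := by
  have hframe : IsFrame (gaborSystem 1 (2 / 5) hatL2) := ⟨_, _, hasFrameBounds_gaborSystem⟩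
  exact ⟨hframe, isRieszSequence_adjointGaborSystem,
    norm_sq_frameOperatorInvSqrt_adjointGaborSystem, one_add_pi_div_four_sub_log_two_ne_one,
    not_isRDualTypeII_adjointGaborSystem, fun h => not_isRDualTypeII_adjointGaborSystem
      (h 1 (2 / 5) hatL2 one_pos (by norm_num) hframe)⟩
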